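/- All systems are finite dimensional. For $d\ge 1$ let $\mathcal S^d_{AB}(\omega)=F\omega F^\dagger$ with $F=\sum_{i,j=0}^{d-1}|i\rangle\langle j|_A\otimes|j\rangle\langle i|_B$ be the $d$-dimensional swap channel on $\mathbb C^d\otimes\mathbb C^d$. For a resource state $\rho_{\hat A\hat B}$ define the simulation errors $$e_{\mathrm{LOCC}}(\mathcal S^d,\rho_{\hat A\hat B})=\inf_{\mathcal L}\tfrac12\big\|\mathcal S^d-\mathcal L(\,\cdot\,\otimes\rho_{\hat A\hat B})\big\|_\diamond,\qquad e_{\mathrm{PPT}}(\mathcal S^d,\rho_{\hat A\hat B})=\inf_{\mathcal P}\tfrac12\big\|\mathcal S^d-\mathcal P(\,\cdot\,\otimes\rho_{\hat A\hat B})\big\|_\diamond .$$ Here $\mathcal L_{AB\hat A\hat B\to AB}$ ranges over all LOCC channels (finitely many rounds, in each of which one party applies a local quantum instrument with finitely many outcomes and communicates the outcome to the other party, followed by local channels; Alice holds $A\hat A$ and Bob holds $B\hat B$), and $\mathcal P_{AB\hat A\hat B\to AB}$ ranges over all C-PPT-P channels, i.e. channels such that $T_{B}\circ\mathcal P\circ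 T_{B\hat B}$ is completely positive, where $T$ denotes the partial transpose. The diamond distance is $\|\mathcal N-\mathcal M\|_\diamond=\sup_{\rho_{RC}}\|(\mathrm{id}_R\otimes\mathcal N)(\rho_{RC})-(\mathrm{id}_R\otimes\mathcal M)(\rho_{RC})\|_1$, with the supremum over all finite-dimensional reference systems $R$ and all states $\rho_{RC}$, $C$ being the input system of the channels. The absence of a resource state, written $\varnothing$, means that $\hat A,\hat B$ are one-dimensional and $\rho_{\hat A\hat B}=1$. Then $$e_{\mathrm{PPT}}(\mathcal S^d,\varnothing)=e_{\mathrm{LOCC}}(\mathcal S^d,\varnothing)=1-\frac1{d^2}.$$ Moreover, if $\rho_{\hat A\hat B}$ is any separable state (a finite convex combination of product states), or any PPT state (a state with $T_{\hat B}(\rho_{\hat A\hat B})\ge 0$), on systems of arbitrary finite dimensions, then likewise $$e_{\mathrm{PPT}}(\mathcal S^d,\rho_{\hat A\hat B})=e_{\mathrm{LOCC}}(\mathcal S^d,\rho_{\hat A\hat B})=1-\frac1{d^2}.$$ -/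

import Mathlib

open scoped ENNReal ComplexOrder MatrixOrder Matrix Kronecker

noncomputable section

namespace BidirectionalTeleportation

/-- Linear maps taking operators on the finite-dimensional system `C` (the Hilbert space `ℂ^C` with
its standard basis) to operators on the system `D`. -/
abbrev SuperOp (C D : Type) : Type := Matrix C C ℂ →ₗ[ℂ] Matrix D D ℂ

/-- A quantum state: a positive semidefinite operator of trace one. -/
def IsState {C : Type} [Fintype C] (ρ : Matrix C C ℂ) : Prop :=
  ρ.PosSemidef ∧ ρ.trace = 1

/-- The map `id_R ⊗ Φ`: apply `Φ` to each block `(⟨r| ⊗ I) X (|s⟩ ⊗ I)` of `X`. -/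
def idTensor (R : Type) {C D : Type} (Φ : SuperOp C D) : SuperOp (R × C) (R × D) where
  toFun X := Matrix.of fun i j => Φ (Matrix.of fun c c' => X (i.1, c) (j.1, c')) i.2 j.2
  map_add' X Y := by
    ext i j
    exact congrFun (congrFun (Φ.map_add (Matrix.of fun c c' => X (i.1, c) (j.1, c'))
      (Matrix.of fun c c' => Y (i.1, c) (j.1, c'))) i.2) j.2
  map_smul' a X := by
    ext i j
    exact congrFun (congrFun (Φ.map_smul a (Matrix.of fun c c' => X (i.1, c) (j.1, c'))) i.2) j.2

/-- The map `Φ ⊗ id_R`. -/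
def tensorId {C D : Type} (Φ : SuperOp C D) (R : Type) : SuperOp (C × R) (D × R) where
  toFun X := Matrix.of fun i j => Φ (Matrix.of fun c c' => X (c, i.2) (c', j.2)) i.1 j.1
  map_add' X Y := by
    ext i j
    exact congrFun (congrFun (Φ.map_add (Matrix.of fun c c' => X (c, i.2) (c', j.2))
      (Matrix.of fun c c' => Y (c, i.2) (c', j.2))) i.1) j.1
  map_smul' a X := by
    ext i j
    exact congrFun (congrFun (Φ.map_smul a (Matrix.of fun c c' => X (c, i.2) (c', j.2))) i.1) j.1

/-- The tensor product `E ⊗ F` of two maps of operators. -/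
def tensorMap {A A' B B' : Type} (E : SuperOp A A') (F : SuperOp B B') :
    SuperOp (A × B) (A' × B') :=
  tensorId E B' ∘ₗ idTensor A F

/-- Complete positivity: `id_n ⊗ Φ` preserves positive semidefiniteness for every `n`. -/
def IsCompletelyPositive {C D : Type} (Φ : SuperOp C D) : Prop :=
  ∀ (n : ℕ) (X : Matrix (Fin n × C) (Fin n × C) ℂ),
    X.PosSemidef → (idTensor (Fin n) Φ X).PosSemidef

def IsTracePreserving {C D : Type} [Fintype C] [Fintype D] (Φ : SuperOp C D) : Prop :=
  ∀ X : Matrix C C ℂ, (Φ X).trace = X.trace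

/-- A quantum channel: a completely positive and trace-preserving map. -/
def IsChannel {C D : Type} [Fintype C] [Fintype D] (Φ : SuperOp C D) : Prop :=
  IsCompletelyPositive Φ ∧ IsTracePreserving Φ

/-- A quantum instrument with finitely many outcomes: completely positive maps whose sum is trace
preserving. -/
def IsInstrument {C D : Type} [Fintype C] [Fintype D] {k : ℕ} (E : Fin k → SuperOp C D) : Prop :=
  (∀ x, IsCompletelyPositive (E x)) ∧ IsTracePreserving (∑ x, E x)

/-- The trace norm `‖X‖₁ = Tr √(Xᴴ X)`. -/
def traceNorm {D : Type} [Fintype D] [DecidableEq D] (X : Matrix D D ℂ) : ℝ :=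
  (CFC.sqrt (Xᴴ * X)).trace.re

/-- The diamond distance `‖N - M‖_⋄`: the supremum, over all finite-dimensional reference systems
`R` and all states `ρ` of `R ⊗ C`, of the trace norm of `(id_R ⊗ N)(ρ) - (id_R ⊗ M)(ρ)`. -/
def diamondDist {C D : Type} [Fintype C] [Fintype D] [DecidableEq D] (N M : SuperOp C D) : ℝ≥0∞ :=
  ⨆ (n : ℕ) (ρ : Matrix (Fin n × C) (Fin n × C) ℂ) (_ : IsState ρ),
    ENNReal.ofReal (traceNorm (idTensor (Fin n) N ρ - idTensor (Fin n) M ρ))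

/-- The partial transpose `T_B`. -/
def partialTransposeB (A B : Type) : SuperOp (A × B) (A × B) where
  toFun X := Matrix.of fun i j => X (i.1, j.2) (j.1, i.2)
  map_add' _ _ := rfl
  map_smul' _ _ := rfl

/-- A PPT state of the bipartite system `A ⊗ B`. -/
def IsPPTState {A B : Type} [Fintype A] [Fintype B] (ρ : Matrix (A × B) (A × B) ℂ) : Prop :=
  IsState ρ ∧ (partialTransposeB A B ρ).PosSemidef

/-- A separable state: a finite convex combination of product states. -/
def IsSeparableState {A B : Type} [Fintype A] [Fintype B] (ρ : Matrix (A × B) (A × B) ℂ) : Prop :=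
  ∃ (k : ℕ) (p : Fin k → ℝ) (σ : Fin k → Matrix A A ℂ) (τ : Fin k → Matrix B B ℂ),
    (∀ x, 0 ≤ p x) ∧ ∑ x, p x = 1 ∧ (∀ x, IsState (σ x)) ∧ (∀ x, IsState (τ x)) ∧
      ρ = ∑ x, (p x : ℂ) • (σ x ⊗ₖ τ x)

/-- A bipartite channel `P` is C-PPT-P (completely positive-partial-transpose preserving) if
`T_{B'} ∘ P ∘ T_B` is completely positive. -/
def IsCPPTP {A B A' B' : Type} [Fintype A] [Fintype B] [Fintype A'] [Fintype B']
    (P : SuperOp (A × B) (A' × B')) : Prop :=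
  IsChannel P ∧
    IsCompletelyPositive (partialTransposeB A' B' ∘ₗ P ∘ₗ partialTransposeB A B)

/-- LOCC channels with a finite number of rounds, from input systems `A` (Alice) and `B` (Bob) to
output systems `A'` and `B'`. A protocol either ends with both parties applying local channels, or
one party applies a local instrument and sends the classical outcome `x` to the other party, after
which they continue with an LOCC protocol that may depend on `x`. -/
inductive IsLOCC {A' B' : Type} [Fintype A'] [Fintype B'] :
    {A B : Type} → [Fintype A] → [Fintype B] → SuperOp (A × B) (A' × B') → Prop
  | localChannels {A B : Type} [Fintype A] [Fintype B] (E : SuperOp A A') (F : SuperOp B B')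
      (hE : IsChannel E) (hF : IsChannel F) : IsLOCC (tensorMap E F)
  | aliceMeasures {A B A₁ : Type} [Fintype A] [Fintype B] [Fintype A₁] {k : ℕ}
      (E : Fin k → SuperOp A A₁) (hE : IsInstrument E)
      (L : Fin k → SuperOp (A₁ × B) (A' × B')) (hL : ∀ x, IsLOCC (L x)) :
      IsLOCC (∑ x, L x ∘ₗ tensorId (E x) B)
  | bobMeasures {A B B₁ : Type} [Fintype A] [Fintype B] [Fintype B₁] {k : ℕ}
      (F : Fin k → SuperOp B B₁) (hF : IsInstrument F)
      (L : Fin k → SuperOp (A × B₁) (A' × B')) (hL : ∀ x, IsLOCC (L x)) :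
      IsLOCC (∑ x, L x ∘ₗ idTensor A (F x))

/-- The map `ω_{AB} ↦ ω_{AB} ⊗ ρ_{ÂB̂}`, with the tensor factors grouped as `(A Â)(B B̂)`, i.e. by
the party that holds them. Here `A₀` and `B₀` stand for `Â` and `B̂`. -/
def appendResource (A B : Type) {A₀ B₀ : Type} (ρ : Matrix (A₀ × B₀) (A₀ × B₀) ℂ) :
    SuperOp (A × B) ((A × A₀) × (B × B₀)) where
  toFun ω := Matrix.of fun i j =>
    ω (i.1.1, i.2.1) (j.1.1, j.2.1) * ρ (i.1.2, i.2.2) (j.1.2, j.2.2)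
  map_add' _ _ := by ext; exact add_mul _ _ _
  map_smul' _ _ := by ext; exact mul_assoc _ _ _

/-- The simulation error of the bipartite channel `N` under C-PPT-P channels, with the resource
state `ρ`: half the infimum of the diamond distance over all C-PPT-P simulations. -/
def errPPT {A B A' B' A₀ B₀ : Type} [Fintype A] [Fintype B] [Fintype A'] [Fintype B']
    [Fintype A₀] [Fintype B₀] [DecidableEq A'] [DecidableEq B']
    (N : SuperOp (A × B) (A' × B')) (ρ : Matrix (A₀ × B₀) (A₀ × B₀) ℂ) : ℝ≥0∞ :=
  ⨅ (P : SuperOp ((A × A₀) × (B × B₀)) (A' × B')) (_ : IsCPPTP P),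
    2⁻¹ * diamondDist N (P ∘ₗ appendResource A B ρ)

/-- The simulation error of the bipartite channel `N` under LOCC, with the resource state `ρ`. -/
def errLOCC {A B A' B' A₀ B₀ : Type} [Fintype A] [Fintype B] [Fintype A'] [Fintype B']
    [Fintype A₀] [Fintype B₀] [DecidableEq A'] [DecidableEq B']
    (N : SuperOp (A × B) (A' × B')) (ρ : Matrix (A₀ × B₀) (A₀ × B₀) ℂ) : ℝ≥0∞ :=
  ⨅ (L : SuperOp ((A × A₀) × (B × B₀)) (A' × B')) (_ : IsLOCC L),
    2⁻¹ * diamondDist N (L ∘ₗ appendResource A B ρ)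

/-- No resource state: the number one, as a state of trivial (one-dimensional) systems. -/
def noResource : Matrix (Unit × Unit) (Unit × Unit) ℂ := 1

/-- The swap operator `F = ∑ i j, |i⟩⟨j| ⊗ |j⟩⟨i|`. -/
def swapOp (d : ℕ) : Matrix (Fin d × Fin d) (Fin d × Fin d) ℂ :=
  ∑ i : Fin d, ∑ j : Fin d, Matrix.single i j (1 : ℂ) ⊗ₖ Matrix.single j i (1 : ℂ)

/-- The `d`-dimensional swap channel `ω ↦ F ω Fᴴ`. -/
def swapChannel (d : ℕ) : SuperOp (Fin d × Fin d) (Fin d × Fin d) where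
  toFun ω := swapOp d * ω * (swapOp d)ᴴ
  map_add' _ _ := by rw [mul_add, add_mul]
  map_smul' _ _ := by rw [Matrix.mul_smul, Matrix.smul_mul, RingHom.id_apply]

end BidirectionalTeleportation

end

noncomputable section

namespace BidirectionalTeleportation

/-! ### The trace norm of Hermitian matrices -/

section TraceNorm

variable {D : Type} [Fintype D] [DecidableEq D]

/-! LOCC channels are C-PPT-P (`IsLOCC.isCPPTP`), so `errPPT ≤ errLOCC`. It remains to bound the
LOCC error from above and the PPT error from below by the same number, for every PPT resource. The
empty resource and separable states are PPT.

Upper bound: both parties measure in the standard basis, tell each other the outcome and prepare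
what they hear. This is the swap followed by complete dephasing of a system of dimension `N = d²`.
The pinching inequality `X ≤ N • pinching X` makes the trace distance between a state and its
pinching at most `1 - 1/N`, whatever the reference system (`traceNorm_sub_pinching_le`).

Lower bound: a C-PPT-P channel fed with a PPT resource is a channel `M` whose partial-transpose
conjugate `ptConj M` is still completely positive. Both channels are tested on a maximally entangled
input. The Choi state of the swap is a pure state `w`, and partial transposition turns the overlap
of `w` with the Choi matrix of `M` into a sum of entries of the Choi matrix of `ptConj M` along a
permutation. That matrix is positive with trace `d²`, so the sum is at most `d²`
(`re_swapOverlap_le`). After normalization by `d⁴` the fidelity is at most `1/d²`, and `w` itself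
witnesses the trace distance `1 - 1/d²`. -/

lemma trace_mul_nonneg {A B : Matrix D D ℂ} (hA : A.PosSemidef) (hB : B.PosSemidef) :
    0 ≤ (A * B).trace := by
  obtain ⟨C, rfl⟩ := CStarAlgebra.nonneg_iff_eq_star_mul_self.mp hA.nonneg
  rw [Matrix.star_eq_conjTranspose, mul_assoc, Matrix.trace_mul_comm]
  exact (hB.mul_mul_conjTranspose_same C).trace_nonneg

/-- A Hermitian matrix is unitarily diagonalizable, and its trace norm is the sum of the absolute
values of its eigenvalues. -/
lemma exists_diagonalization {H : Matrix D D ℂ} (hH : H.IsHermitian) :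
    ∃ (U : Matrix D D ℂ) (a : D → ℝ), U * Uᴴ = 1 ∧ Uᴴ * U = 1 ∧
      H = U * Matrix.diagonal (fun i => (a i : ℂ)) * Uᴴ ∧ traceNorm H = ∑ i, |a i| := by
  set U : Matrix D D ℂ := (hH.eigenvectorUnitary : Matrix D D ℂ) with hU
  set a := hH.eigenvalues with ha
  have hUU : U * Uᴴ = 1 := Matrix.mem_unitaryGroup_iff.mp hH.eigenvectorUnitary.2
  have hUU' : Uᴴ * U = 1 := Matrix.mem_unitaryGroup_iff'.mp hH.eigenvectorUnitary.2
  have hspec : H = U * Matrix.diagonal (fun i => (a i : ℂ)) * Uᴴ := by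
    conv_lhs => rw [hH.spectral_theorem, Unitary.conjStarAlgAut_apply]
    rfl
  refine ⟨U, a, hUU, hUU', hspec, ?_⟩
  have key : ∀ f g : D → ℂ, (U * Matrix.diagonal f * Uᴴ) * (U * Matrix.diagonal g * Uᴴ) =
      U * Matrix.diagonal (fun i => f i * g i) * Uᴴ := by
    intro f g
    calc _ = U * Matrix.diagonal f * (Uᴴ * U) * Matrix.diagonal g * Uᴴ := by
          simp only [mul_assoc]
      _ = _ := by rw [hUU', mul_one, mul_assoc U, Matrix.diagonal_mul_diagonal]
  -- By uniqueness of the positive square root, it suffices to square the diagonal matrix of the `|a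
  -- i|` in the eigenbasis.
  have hsqrt : CFC.sqrt (Hᴴ * H) = U * Matrix.diagonal (fun i => ((|a i| : ℝ) : ℂ)) * Uᴴ := by
    refine CFC.sqrt_unique ?_ ?_
    · rw [hH.eq, key]
      conv_rhs => rw [hspec, key]
      congr 3
      ext i
      rw [← Complex.ofReal_mul, ← Complex.ofReal_mul, abs_mul_abs_self]
    · refine ((Matrix.PosSemidef.diagonal ?_).mul_mul_conjTranspose_same U).nonneg
      intro i
      exact Complex.zero_le_real.mpr (abs_nonneg (a i))
  rw [traceNorm, hsqrt, Matrix.trace_mul_comm, ← mul_assoc, hUU', one_mul, Matrix.trace_diagonal]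
  simp

/-- The Jordan decomposition computes the trace norm. -/
lemma exists_jordan_decomposition {H : Matrix D D ℂ} (hH : H.IsHermitian) :
    ∃ P Q : Matrix D D ℂ, P.PosSemidef ∧ Q.PosSemidef ∧ H = P - Q ∧
      traceNorm H = P.trace.re + Q.trace.re := by
  obtain ⟨U, a, -, hU, hspec, hn⟩ := exists_diagonalization hH
  refine ⟨U * Matrix.diagonal (fun i => ((a i ⊔ 0 : ℝ) : ℂ)) * Uᴴ,
    U * Matrix.diagonal (fun i => ((-a i ⊔ 0 : ℝ) : ℂ)) * Uᴴ, ?_, ?_, ?_, ?_⟩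
  · refine (Matrix.PosSemidef.diagonal fun i => ?_).mul_mul_conjTranspose_same U
    exact Complex.zero_le_real.mpr (le_max_right _ _)
  · refine (Matrix.PosSemidef.diagonal fun i => ?_).mul_mul_conjTranspose_same U
    exact Complex.zero_le_real.mpr (le_max_right _ _)
  · rw [← sub_mul, ← mul_sub, Matrix.diagonal_sub]
    conv_lhs => rw [hspec]
    congr 3
    ext i
    rw [← Complex.ofReal_sub]
    congr 1
    rcases le_total (a i) 0 with h | h <;> simp [h]
  · rw [hn, Matrix.trace_mul_comm, ← mul_assoc, hU, one_mul, Matrix.trace_mul_comm, ← mul_assoc, hU,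
      one_mul, Matrix.trace_diagonal, Matrix.trace_diagonal, Complex.re_sum, Complex.re_sum,
      ← Finset.sum_add_distrib]
    refine Finset.sum_congr rfl fun i _ => ?_
    rw [Complex.ofReal_re, Complex.ofReal_re]
    rcases le_total (a i) 0 with h | h <;> simp [h, abs_of_nonneg, abs_of_nonpos]

/-- In an eigenbasis of `P - Q` each eigenvalue is a difference of diagonal entries of `P` and `Q`,
which are nonnegative, so its modulus is at most their sum. -/
lemma traceNorm_sub_le {P Q : Matrix D D ℂ} (hP : P.PosSemidef) (hQ : Q.PosSemidef) :
    traceNorm (P - Q) ≤ P.trace.re + Q.trace.re := by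
  obtain ⟨U, a, hU', hU, hspec, hn⟩ := exists_diagonalization (hP.1.sub hQ.1)
  have hP' := hP.conjTranspose_mul_mul_same U
  have hQ' := hQ.conjTranspose_mul_mul_same U
  have htr : ∀ X : Matrix D D ℂ, (Uᴴ * X * U).trace = X.trace := fun X => by
    rw [Matrix.trace_mul_comm, ← mul_assoc, hU', one_mul]
  have hdiag : Uᴴ * P * U - Uᴴ * Q * U = Matrix.diagonal (fun i => (a i : ℂ)) := by
    rw [← sub_mul, ← mul_sub, hspec]
    calc _ = (Uᴴ * U) * Matrix.diagonal (fun i => (a i : ℂ)) * (Uᴴ * U) := by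
          simp only [mul_assoc]
      _ = _ := by rw [hU, one_mul, mul_one]
  rw [hn, ← htr P, ← htr Q, Matrix.trace, Matrix.trace, Complex.re_sum, Complex.re_sum,
    ← Finset.sum_add_distrib]
  refine Finset.sum_le_sum fun i _ => ?_
  have h1 := (Complex.le_def.mp (hP'.diag_nonneg (i := i))).1
  have h2 := (Complex.le_def.mp (hQ'.diag_nonneg (i := i))).1
  have h3 := congrArg Complex.re (congrFun (congrFun hdiag i) i)
  simp only [Matrix.sub_apply, Complex.sub_re, Matrix.diagonal_apply_eq, Complex.ofReal_re,
    Complex.zero_re, Matrix.diag_apply] at h1 h2 h3 ⊢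
  rw [← h3, abs_le]
  constructor <;> linarith

/-- The overlap of a traceless Hermitian matrix with a pure state is at most half its trace norm. -/
lemma two_mul_expectation_le_traceNorm {H : Matrix D D ℂ} (hH : H.IsHermitian)
    (h0 : H.trace = 0) (w : D → ℂ) (hw : star w ⬝ᵥ w = 1) :
    2 * (star w ⬝ᵥ H *ᵥ w).re ≤ traceNorm H := by
  obtain ⟨P, Q, hP, hQ, rfl, hn⟩ := exists_jordan_decomposition hH
  -- `E` is the projection onto the complement of `w`. Positivity of `Tr (P E)` bounds the
  -- expectation of `P` in `w` by `Tr P`. That of `Q` is nonnegative, and tracelessness gives `Tr P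
  -- = Tr Q`, so the trace norm is `2 Tr P`.
  set E : Matrix D D ℂ := 1 - Matrix.vecMulVec w (star w) with hE
  have hEE : Eᴴ * E = E := by
    have hherm : Eᴴ = E := by
      rw [hE, Matrix.conjTranspose_sub, Matrix.conjTranspose_one, Matrix.conjTranspose_vecMulVec,
        star_star]
    have hidem : Matrix.vecMulVec w (star w) * Matrix.vecMulVec w (star w) =
        Matrix.vecMulVec w (star w) := by
      rw [Matrix.vecMulVec_mul_vecMulVec, hw]
      simp
    rw [hherm, hE, sub_mul, mul_sub, mul_sub, hidem]
    simp
  have hEpos : E.PosSemidef := hEE ▸ Matrix.posSemidef_conjTranspose_mul_self E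
  have hP1 := (Complex.le_def.mp (trace_mul_nonneg hP hEpos)).1
  have hexp : (P * Matrix.vecMulVec w (star w)).trace = star w ⬝ᵥ P *ᵥ w := by
    rw [Matrix.mul_vecMulVec, Matrix.trace_vecMulVec, dotProduct_comm]
  rw [hE, mul_sub, mul_one, Matrix.trace_sub, hexp, Complex.sub_re, Complex.zero_re] at hP1
  have hQ1 := (Complex.le_def.mp (hQ.dotProduct_mulVec_nonneg w)).1
  have ht := congrArg Complex.re h0
  rw [Matrix.trace_sub, Complex.sub_re] at ht
  rw [Matrix.sub_mulVec, dotProduct_sub, Complex.sub_re, hn]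
  simp only [Complex.zero_re] at *
  linarith

end TraceNorm

/-! ### Complete positivity -/

section CompletelyPositive

variable {A B C D E : Type}

@[simp] lemma idTensor_apply (R : Type) (Φ : SuperOp C D) (X : Matrix (R × C) (R × C) ℂ)
    (i j : R × D) :
    idTensor R Φ X i j = Φ (Matrix.of fun c c' => X (i.1, c) (j.1, c')) i.2 j.2 := rfl

@[simp] lemma tensorId_apply (R : Type) (Φ : SuperOp C D) (X : Matrix (C × R) (C × R) ℂ)
    (i j : D × R) :
    tensorId Φ R X i j = Φ (Matrix.of fun c c' => X (c, i.2) (c', j.2)) i.1 j.1 := rfl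

@[simp] lemma partialTransposeB_apply (X : Matrix (A × B) (A × B) ℂ) (i j : A × B) :
    partialTransposeB A B X i j = X (i.1, j.2) (j.1, i.2) := rfl

@[simp] lemma appendResource_apply {A₀ B₀ : Type} (ρ : Matrix (A₀ × B₀) (A₀ × B₀) ℂ)
    (X : Matrix (A × B) (A × B) ℂ) (i j : (A × A₀) × (B × B₀)) :
    appendResource A B ρ X i j =
      X (i.1.1, i.2.1) (j.1.1, j.2.1) * ρ (i.1.2, i.2.2) (j.1.2, j.2.2) := rfl

/-- Relabelling a finite reference system by `Fin n` reduces it to the references in the definition.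
-/
lemma IsCompletelyPositive.posSemidef_idTensor {Φ : SuperOp C D} (h : IsCompletelyPositive Φ)
    (R : Type) [Fintype R] {X : Matrix (R × C) (R × C) ℂ} (hX : X.PosSemidef) :
    (idTensor R Φ X).PosSemidef := by
  let e := Fintype.equivFin R
  have := h _ _ (hX.submatrix (Prod.map e.symm id))
  convert this.submatrix (Prod.map e id) using 1
  ext i j
  simp

lemma IsCompletelyPositive.comp {Φ : SuperOp C D} {Ψ : SuperOp D E}
    (hΨ : IsCompletelyPositive Ψ) (hΦ : IsCompletelyPositive Φ) :
    IsCompletelyPositive (Ψ ∘ₗ Φ) :=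
  fun n X hX => hΨ n _ (hΦ n X hX)

lemma IsCompletelyPositive.sum {ι : Type*} [Fintype ι] {Φ : ι → SuperOp C D}
    (h : ∀ x, IsCompletelyPositive (Φ x)) : IsCompletelyPositive (∑ x, Φ x) := by
  intro n X hX
  convert Matrix.posSemidef_sum Finset.univ fun x _ => h x n X hX using 1
  ext i j
  simp [Matrix.sum_apply]

/-- The spectator system `R` is absorbed into the reference. -/
lemma IsCompletelyPositive.idTensor {Φ : SuperOp C D} (h : IsCompletelyPositive Φ)
    (R : Type) [Fintype R] : IsCompletelyPositive (idTensor R Φ) := fun n _ hX =>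
  (h.posSemidef_idTensor (Fin n × R) (hX.submatrix (Equiv.prodAssoc _ _ _))).submatrix
    (Equiv.prodAssoc _ _ _).symm

lemma IsCompletelyPositive.tensorId {Φ : SuperOp C D} (h : IsCompletelyPositive Φ)
    (R : Type) [Fintype R] : IsCompletelyPositive (tensorId Φ R) := fun n _ hX =>
  (h.posSemidef_idTensor (Fin n × R)
    (hX.submatrix fun i : (Fin n × R) × C => (i.1.1, (i.2, i.1.2)))).submatrix
    fun i : Fin n × (D × R) => ((i.1, i.2.2), i.2.1)

lemma IsCompletelyPositive.tensorMap {A' B' : Type} [Fintype A] [Fintype B']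
    {Φ : SuperOp A A'} {Ψ : SuperOp B B'}
    (hΦ : IsCompletelyPositive Φ) (hΨ : IsCompletelyPositive Ψ) :
    IsCompletelyPositive (tensorMap Φ Ψ) :=
  (hΦ.tensorId B').comp (hΨ.idTensor A)

/-- The map `T ∘ Φ ∘ T`, with `T` the transpose. -/
def transposed (Φ : SuperOp C D) : SuperOp C D where
  toFun X := (Φ Xᵀ)ᵀ
  map_add' X Y := by rw [Matrix.transpose_add, map_add, Matrix.transpose_add]
  map_smul' a X := by
    rw [Matrix.transpose_smul, map_smul, Matrix.transpose_smul, RingHom.id_apply]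

/-- Conjugating by the transpose of reference and system together has the same effect as conjugating
by that of the system alone, because the reference is transposed twice; the full transpose preserves
positivity. -/
lemma IsCompletelyPositive.transposed {Φ : SuperOp C D} (h : IsCompletelyPositive Φ) :
    IsCompletelyPositive (transposed Φ) :=
  fun n _ hX => (h n _ hX.transpose).transpose

lemma isCompletelyPositive_appendResource {A₀ B₀ : Type} [Fintype A] [Fintype B] [Fintype A₀]
    [Fintype B₀] {ρ : Matrix (A₀ × B₀) (A₀ × B₀) ℂ} (hρ : ρ.PosSemidef) :
    IsCompletelyPositive (appendResource A B ρ) := fun n _ hX =>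
  (hX.kronecker hρ).submatrix fun i : Fin n × ((A × A₀) × (B × B₀)) =>
    ((i.1, (i.2.1.1, i.2.2.1)), (i.2.1.2, i.2.2.2))

lemma isTracePreserving_appendResource {A₀ B₀ : Type} [Fintype A] [Fintype B] [Fintype A₀]
    [Fintype B₀] {ρ : Matrix (A₀ × B₀) (A₀ × B₀) ℂ} (hρ : ρ.trace = 1) :
    IsTracePreserving (appendResource A B ρ) := by
  intro X
  have h : (appendResource A B ρ X).trace = X.trace * ρ.trace := by
    rw [Matrix.trace, Matrix.trace, Matrix.trace, Fintype.sum_mul_sum, ← Fintype.sum_prod_type']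
    exact (Equiv.prodProdProdComm A A₀ B B₀).sum_comp fun i => X i.1 i.1 * ρ i.2 i.2
  rw [h, hρ, mul_one]

lemma IsTracePreserving.comp [Fintype C] [Fintype D] [Fintype E] {Φ : SuperOp C D}
    {Ψ : SuperOp D E} (hΨ : IsTracePreserving Ψ) (hΦ : IsTracePreserving Φ) :
    IsTracePreserving (Ψ ∘ₗ Φ) :=
  fun X => (hΨ _).trans (hΦ X)

lemma trace_idTensor [Fintype D] (R : Type) [Fintype R] (Φ : SuperOp C D)
    (X : Matrix (R × C) (R × C) ℂ) :
    (idTensor R Φ X).trace = ∑ r, (Φ (Matrix.of fun c c' => X (r, c) (r, c'))).trace := by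
  simp [Matrix.trace, Fintype.sum_prod_type]

lemma IsTracePreserving.idTensor [Fintype C] [Fintype D] {Φ : SuperOp C D}
    (h : IsTracePreserving Φ) (R : Type) [Fintype R] : IsTracePreserving (idTensor R Φ) := by
  intro X
  rw [trace_idTensor]
  simp_rw [h _]
  simp [Matrix.trace, Fintype.sum_prod_type]

lemma IsTracePreserving.tensorId [Fintype C] [Fintype D] {Φ : SuperOp C D}
    (h : IsTracePreserving Φ) (R : Type) [Fintype R] : IsTracePreserving (tensorId Φ R) := by
  intro X
  have h1 : (BidirectionalTeleportation.tensorId Φ R X).trace =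
      (BidirectionalTeleportation.idTensor R Φ (X.submatrix Prod.swap Prod.swap)).trace := by
    simp only [Matrix.trace, Fintype.sum_prod_type]
    exact Finset.sum_comm
  rw [h1, h.idTensor R]
  exact (Equiv.prodComm R C).sum_comp fun i => X i i

end CompletelyPositive

/-! ### LOCC channels are C-PPT-P -/

section LOCC

variable {A B A' B' : Type}

/-- The partial-transpose conjugate `T_{B'} ∘ P ∘ T_B`. -/
def ptConj (P : SuperOp (A × B) (A' × B')) : SuperOp (A × B) (A' × B') :=
  partialTransposeB A' B' ∘ₗ P ∘ₗ partialTransposeB A B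

/-- The two intermediate partial transposes cancel, so `ptConj` is functorial and can be computed
round by round. -/
lemma ptConj_comp {A₁ B₁ : Type} (P : SuperOp (A₁ × B₁) (A' × B')) (Q : SuperOp (A × B) (A₁ × B₁)) :
    ptConj (P ∘ₗ Q) = ptConj P ∘ₗ ptConj Q := rfl

lemma ptConj_sum {ι : Type*} [Fintype ι] (P : ι → SuperOp (A × B) (A' × B')) :
    ptConj (∑ x, P x) = ∑ x, ptConj (P x) := by
  ext X : 1
  simp [ptConj]

lemma ptConj_tensorId (Φ : SuperOp A A') : ptConj (tensorId Φ B) = tensorId Φ B := rfl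

lemma ptConj_idTensor (Φ : SuperOp B B') : ptConj (idTensor A Φ) = idTensor A (transposed Φ) := rfl

lemma ptConj_tensorMap (Φ : SuperOp A A') (Ψ : SuperOp B B') :
    ptConj (tensorMap Φ Ψ) = tensorMap Φ (transposed Ψ) := by
  rw [tensorMap, ptConj_comp, ptConj_tensorId, ptConj_idTensor, tensorMap]

lemma ptConj_appendResource {A₀ B₀ : Type} (ρ : Matrix (A₀ × B₀) (A₀ × B₀) ℂ) :
    ptConj (appendResource A B ρ) = appendResource A B (partialTransposeB A₀ B₀ ρ) := rfl

lemma IsChannel.isCPPTP [Fintype A] [Fintype B] [Fintype A'] [Fintype B']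
    {P : SuperOp (A × B) (A' × B')} (h : IsChannel P) (h' : IsCompletelyPositive (ptConj P)) :
    IsCPPTP P := ⟨h, h'⟩

/-- Postcomposing a family of trace-preserving maps with the outcomes of an instrument. -/
lemma isTracePreserving_sum_comp {C D E : Type} [Fintype C] [Fintype D] [Fintype E] {k : ℕ}
    {L : Fin k → SuperOp D E} {F : Fin k → SuperOp C D} (hL : ∀ x, IsTracePreserving (L x))
    (hF : IsTracePreserving (∑ x, F x)) : IsTracePreserving (∑ x, L x ∘ₗ F x) := by
  intro X
  rw [← hF X]
  simp only [LinearMap.sum_apply, LinearMap.comp_apply, Matrix.trace_sum]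
  exact Finset.sum_congr rfl fun x _ => hL x _

lemma sum_tensorId {ι : Type*} [Fintype ι] (Φ : ι → SuperOp A A') (R : Type) :
    tensorId (∑ x, Φ x) R = ∑ x, tensorId (Φ x) R := by
  ext X i j
  simp [Matrix.sum_apply]

lemma sum_idTensor {ι : Type*} [Fintype ι] (Φ : ι → SuperOp A A') (R : Type) :
    idTensor R (∑ x, Φ x) = ∑ x, idTensor R (Φ x) := by
  ext X i j
  simp [Matrix.sum_apply]

/-- Induction over the rounds: `ptConj` fixes Alice's local maps and replaces Bob's by their
transposed maps, which are again completely positive. -/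
lemma IsLOCC.isCPPTP [Fintype A'] [Fintype B'] [Fintype A] [Fintype B]
    {P : SuperOp (A × B) (A' × B')} (h : IsLOCC P) : IsCPPTP P := by
  induction h with
  | localChannels E F hE hF =>
    refine IsChannel.isCPPTP ⟨hE.1.tensorMap hF.1, (hE.2.tensorId _).comp (hF.2.idTensor _)⟩ ?_
    rw [ptConj_tensorMap]
    exact hE.1.tensorMap hF.1.transposed
  | @aliceMeasures A B A₁ _ _ _ k E hE L hL ih =>
    refine IsChannel.isCPPTP ⟨.sum fun x => (ih x).1.1.comp ((hE.1 x).tensorId B),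
      isTracePreserving_sum_comp (fun x => (ih x).1.2) ?_⟩ ?_
    · rw [← sum_tensorId]
      exact hE.2.tensorId B
    · rw [ptConj_sum]
      refine .sum fun x => ?_
      rw [ptConj_comp, ptConj_tensorId]
      exact (ih x).2.comp ((hE.1 x).tensorId B)
  | @bobMeasures A B B₁ _ _ _ k F hF L hL ih =>
    refine IsChannel.isCPPTP ⟨.sum fun x => (ih x).1.1.comp ((hF.1 x).idTensor A),
      isTracePreserving_sum_comp (fun x => (ih x).1.2) ?_⟩ ?_
    · rw [← sum_idTensor]
      exact hF.2.idTensor A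
    · rw [ptConj_sum]
      refine .sum fun x => ?_
      rw [ptConj_comp, ptConj_idTensor]
      exact (ih x).2.comp ((hF.1 x).transposed.idTensor A)

end LOCC

/-! ### Resource states -/

section Resource

variable {A₀ B₀ : Type} [Fintype A₀] [Fintype B₀]

lemma IsSeparableState.isPPTState {ρ : Matrix (A₀ × B₀) (A₀ × B₀) ℂ} (h : IsSeparableState ρ) :
    IsPPTState ρ := by
  obtain ⟨k, p, σ, τ, hp, hp1, hσ, hτ, rfl⟩ := h
  refine ⟨⟨Matrix.posSemidef_sum _ fun x _ => ((hσ x).1.kronecker (hτ x).1).smul ?_, ?_⟩, ?_⟩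
  · exact_mod_cast hp x
  · simp only [Matrix.trace_sum, Matrix.trace_smul, Matrix.trace_kronecker, (hσ _).2, (hτ _).2]
    simp only [mul_one, smul_eq_mul]
    exact_mod_cast hp1
  · rw [map_sum]
    simp_rw [map_smul]
    -- By definition the partial transpose of `σ x ⊗ₖ τ x` is `σ x ⊗ₖ (τ x)ᵀ`.
    refine Matrix.posSemidef_sum _ fun x _ => Matrix.PosSemidef.smul
      (x := partialTransposeB A₀ B₀ (σ x ⊗ₖ τ x)) ((hσ x).1.kronecker (hτ x).1.transpose) ?_
    exact_mod_cast hp x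

lemma isPPTState_noResource : IsPPTState noResource := by
  refine ⟨⟨Matrix.PosSemidef.one, by simp [noResource]⟩, ?_⟩
  convert Matrix.PosSemidef.one (n := Unit × Unit) (R := ℂ) using 1
  ext i j
  obtain rfl := Subsingleton.elim i j
  simp [noResource]

end Resource

/-! ### The swap channel and its simulation by measuring and preparing -/

section Swap

variable {d : ℕ}

lemma swapOp_apply (i j : Fin d × Fin d) : swapOp d i j = if i = j.swap then 1 else 0 := by
  obtain ⟨a, b⟩ := i
  obtain ⟨c, e⟩ := j
  simp only [swapOp, Matrix.sum_apply, Matrix.kroneckerMap_apply, Matrix.single_apply,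
    Prod.swap_prod_mk, Prod.mk.injEq, mul_ite, mul_one, mul_zero, ← ite_and]
  rw [Finset.sum_eq_single a, Finset.sum_eq_single b]
  · congr 1
    simp only [true_and]
  · intro y _ hy
    simp [hy]
  · simp
  · intro x _ hx
    simp [hx]
  · simp

lemma swapChannel_apply (ω : Matrix (Fin d × Fin d) (Fin d × Fin d) ℂ) :
    swapChannel d ω = ω.submatrix Prod.swap Prod.swap := by
  have hF : ∀ i k : Fin d × Fin d, swapOp d i k = if k = i.swap then 1 else 0 := fun i k => by
    rw [swapOp_apply]
    congr 1
    rw [eq_iff_iff]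
    exact ⟨fun h => by simp [h], fun h => by simp [h]⟩
  ext i j
  simp [swapChannel, Matrix.mul_apply, hF]

lemma idTensor_swapChannel (R : Type) (X : Matrix (R × (Fin d × Fin d)) (R × (Fin d × Fin d)) ℂ) :
    idTensor R (swapChannel d) X =
      X.submatrix (Prod.map id Prod.swap) (Prod.map id Prod.swap) := by
  ext i j
  rw [idTensor_apply, swapChannel_apply]
  rfl

lemma isCompletelyPositive_swapChannel : IsCompletelyPositive (swapChannel d) := fun n X hX => by
  rw [idTensor_swapChannel]
  exact hX.submatrix _

lemma isTracePreserving_swapChannel : IsTracePreserving (swapChannel d) := fun X => by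
  rw [swapChannel_apply]
  exact (Equiv.prodComm (Fin d) (Fin d)).sum_comp fun i => X i i

/-- The branch with outcome `x` of the measurement of `Fin d` in the standard basis, discarding the
measured system and the system `A₀`. -/
def outcome (A₀ : Type) [Fintype A₀] (x : Fin d) : SuperOp (Fin d × A₀) Unit where
  toFun X := Matrix.of fun _ _ => ∑ a, X (x, a) (x, a)
  map_add' X Y := by ext; exact Finset.sum_add_distrib
  map_smul' c X := by ext; exact (Finset.mul_sum _ _ _).symm

/-- The preparation of the standard basis state `x`. -/
def prepare (x : Fin d) : SuperOp Unit (Fin d) where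
  toFun X := X () () • Matrix.single x x 1
  map_add' _ _ := add_smul _ _ _
  map_smul' _ _ := mul_smul _ _ _

lemma outcome_apply (A₀ : Type) [Fintype A₀] (x : Fin d) (X i j) :
    outcome A₀ x X i j = ∑ a, X (x, a) (x, a) := rfl

lemma prepare_apply (x : Fin d) (X) : prepare x X = X () () • Matrix.single x x 1 := rfl

lemma isInstrument_outcome (A₀ : Type) [Fintype A₀] :
    IsInstrument (outcome A₀ : Fin d → SuperOp (Fin d × A₀) Unit) := by
  refine ⟨fun x n X hX => ?_, fun X => ?_⟩
  · convert Matrix.posSemidef_sum Finset.univ fun a _ =>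
      hX.submatrix fun i : Fin n × Unit => (i.1, (x, a)) using 1
    ext i j
    simp [outcome_apply, Matrix.sum_apply]
  · simp [Matrix.trace, Matrix.sum_apply, outcome_apply, Fintype.sum_prod_type]

lemma isChannel_prepare (x : Fin d) : IsChannel (prepare x) := by
  refine ⟨fun n X hX => ?_, fun X => ?_⟩
  · have hx : (Matrix.single x x (1 : ℂ)).PosSemidef := by
      rw [← Matrix.diagonal_single]
      exact .diagonal (Pi.single_nonneg.mpr zero_le_one)
    exact (hX.kronecker hx).submatrix fun i : Fin n × Fin d => ((i.1, ()), i.2)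
  · simp [prepare_apply, Matrix.trace]

/-- Both parties measure in the standard basis, exchange their outcomes and prepare the outcome of
the other party. -/
def measureExchange (d : ℕ) (A₀ B₀ : Type) [Fintype A₀] [Fintype B₀] :
    SuperOp ((Fin d × A₀) × (Fin d × B₀)) (Fin d × Fin d) :=
  ∑ x : Fin d, (∑ y : Fin d, tensorMap (prepare y) (prepare x) ∘ₗ idTensor Unit (outcome B₀ y)) ∘ₗ
    tensorId (outcome A₀ x) (Fin d × B₀)

lemma isLOCC_measureExchange (A₀ B₀ : Type) [Fintype A₀] [Fintype B₀] :
    IsLOCC (measureExchange d A₀ B₀) :=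
  .aliceMeasures _ (isInstrument_outcome A₀) _ fun x =>
    .bobMeasures _ (isInstrument_outcome B₀) _ fun y =>
      .localChannels _ _ (isChannel_prepare y) (isChannel_prepare x)

/-- The protocol discards `A₀` and `B₀`, so the resource enters only through its trace. What is left
is the dephased swap. -/
lemma measureExchange_appendResource {A₀ B₀ : Type} [Fintype A₀] [Fintype B₀]
    {ρ : Matrix (A₀ × B₀) (A₀ × B₀) ℂ} (hρ : ρ.trace = 1)
    (ω : Matrix (Fin d × Fin d) (Fin d × Fin d) ℂ) :
    measureExchange d A₀ B₀ (appendResource (Fin d) (Fin d) ρ ω) =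
      Matrix.diagonal fun c => ω c.swap c.swap := by
  have hρ' : ∑ b, ∑ a, ρ (a, b) (a, b) = 1 := by
    rw [Finset.sum_comm, ← hρ, Matrix.trace, Fintype.sum_prod_type]
    rfl
  ext ⟨a, b⟩ ⟨a', b'⟩
  have : ∀ x y : Fin d, (tensorMap (prepare y) (prepare x) (idTensor Unit (outcome B₀ y)
      (tensorId (outcome A₀ x) (Fin d × B₀) (appendResource (Fin d) (Fin d) ρ ω)))) (a, b) (a', b') =
      ω (x, y) (x, y) * (Matrix.single y y 1 a a' * Matrix.single x x 1 b b') := by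
    intro x y
    simp only [tensorMap, LinearMap.comp_apply, tensorId_apply, idTensor_apply, prepare_apply,
      outcome_apply, Matrix.smul_apply, Matrix.of_apply, appendResource_apply, smul_eq_mul,
      ← Finset.mul_sum, hρ', mul_one]
    ring
  simp only [measureExchange, LinearMap.sum_apply, LinearMap.comp_apply, Matrix.sum_apply, this]
  -- Alice outputs Bob's outcome and conversely, so only `x = b`, `y = a` contributes.
  rw [Finset.sum_eq_single b, Finset.sum_eq_single a]
  · by_cases h1 : a = a' <;> by_cases h2 : b = b' <;>
      simp [h1, h2]
  · intro y _ hy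
    simp [Matrix.single_apply, hy]
  · simp
  · intro x _ hx
    simp [Matrix.single_apply, hx]
  · simp

end Swap

/-! ### The pinching inequality -/

section Pinching

variable {R C : Type} [Fintype R] [Fintype C] [DecidableEq C]

/-- The pinching of `X` with respect to the standard basis of the second system. -/
def pinching (X : Matrix (R × C) (R × C) ℂ) : Matrix (R × C) (R × C) ℂ :=
  Matrix.of fun i j => if i.2 = j.2 then X i j else 0

lemma trace_pinching (X : Matrix (R × C) (R × C) ℂ) : (pinching X).trace = X.trace := by
  simp [Matrix.trace, pinching]

/-- With `P c` the projection onto the basis vector `c` and `V c c' = P c - P c'`, expanding the sum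
of all `V c c' * X * (V c c')ᴴ` gives `2 N • pinching X - 2 • X`: the diagonal terms give pinchings
and the cross terms resum to `X`. -/
lemma posSemidef_card_smul_pinching_sub [DecidableEq R] {X : Matrix (R × C) (R × C) ℂ} (hX : X.PosSemidef) :
    ((Fintype.card C : ℂ) • pinching X - X).PosSemidef := by
  let V : C → C → Matrix (R × C) (R × C) ℂ := fun c c' =>
    Matrix.diagonal fun i => (if i.2 = c then 1 else 0) - (if i.2 = c' then 1 else 0)
  have key : (Fintype.card C : ℂ) • pinching X - X =
      (2⁻¹ : ℂ) • ∑ c, ∑ c', V c c' * X * (V c c')ᴴ := by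
    ext i j
    simp only [V, pinching, Matrix.sub_apply, Matrix.smul_apply, Matrix.sum_apply,
      Matrix.diagonal_conjTranspose, Matrix.mul_diagonal, Matrix.diagonal_mul, Matrix.of_apply,
      smul_eq_mul, Pi.star_apply, star_sub, apply_ite star, star_one, star_zero]
    have h : ∀ c c' : C, ((if i.2 = c then (1 : ℂ) else 0) - if i.2 = c' then 1 else 0) * X i j *
        ((if j.2 = c then 1 else 0) - if j.2 = c' then 1 else 0) = X i j *
        ((if i.2 = c then if j.2 = c then 1 else 0 else 0) -
          (if i.2 = c then if j.2 = c' then 1 else 0 else 0) -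
          (if j.2 = c then if i.2 = c' then 1 else 0 else 0) +
          (if i.2 = c' then if j.2 = c' then 1 else 0 else 0)) := by
      intro c c'
      split_ifs <;> ring
    simp only [h, ← Finset.mul_sum, Finset.sum_add_distrib, Finset.sum_sub_distrib,
      Finset.sum_const, Finset.sum_ite_eq, Finset.mem_univ, if_true, Finset.card_univ, nsmul_eq_mul]
    simp only [Finset.sum_ite_irrel, Finset.sum_ite_eq, Finset.mem_univ, if_true,
      Finset.sum_const_zero, eq_comm (a := j.2) (b := i.2)]
    split_ifs <;> ring
  rw [key]
  refine Matrix.PosSemidef.smul (Matrix.posSemidef_sum _ fun c _ => Matrix.posSemidef_sum _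
    fun c' _ => hX.mul_mul_conjTranspose_same _) ?_
  rw [show (2⁻¹ : ℂ) = ((2⁻¹ : ℝ) : ℂ) by simp, Complex.zero_le_real]
  norm_num

lemma traceNorm_sub_pinching_le [DecidableEq R] [Nonempty C] {X : Matrix (R × C) (R × C) ℂ} (hX : IsState X) :
    traceNorm (X - pinching X) ≤ 2 * (1 - 1 / (Fintype.card C : ℝ)) := by
  set N : ℝ := (Fintype.card C : ℝ) with hN
  have hN1 : 1 ≤ N := Nat.one_le_cast.mpr (Fintype.card_pos (α := C))
  have hN0 : (N : ℂ) ≠ 0 := by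
    rw [Complex.ofReal_ne_zero]
    positivity
  have hNC : (Fintype.card C : ℂ) = (N : ℂ) := by simp [hN]
  -- A difference of two positive matrices, each of trace `1 - 1/N`.
  have hdec : X - pinching X = ((1 - 1 / N : ℝ) : ℂ) • X -
      ((1 / N : ℝ) : ℂ) • ((N : ℂ) • pinching X - X) := by
    rw [smul_sub, smul_smul]
    push_cast
    rw [one_div_mul_cancel hN0, sub_smul, one_smul, one_smul]
    abel
  have hP : (((1 - 1 / N : ℝ) : ℂ) • X).PosSemidef := hX.1.smul <| by
    rw [Complex.zero_le_real, sub_nonneg, div_le_one (by positivity)]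
    exact hN1
  have hQ : (((1 / N : ℝ) : ℂ) • ((N : ℂ) • pinching X - X)).PosSemidef := by
    rw [← hNC]
    refine (posSemidef_card_smul_pinching_sub hX.1).smul ?_
    rw [Complex.zero_le_real]
    positivity
  rw [hdec]
  refine (traceNorm_sub_le hP hQ).trans_eq ?_
  simp only [Matrix.trace_smul, Matrix.trace_sub, trace_pinching, hX.2, smul_eq_mul, mul_one,
    Complex.re_ofReal_mul, Complex.sub_re, Complex.ofReal_re, Complex.one_re]
  field_simp
  ring

end Pinching

/-! ### The upper bound -/

lemma diamondDist_swapChannel_measureExchange_le {d : ℕ} (hd : 1 ≤ d) {A₀ B₀ : Type} [Fintype A₀]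
    [Fintype B₀] {ρ : Matrix (A₀ × B₀) (A₀ × B₀) ℂ} (hρ : ρ.trace = 1) :
    diamondDist (swapChannel d)
      (measureExchange d A₀ B₀ ∘ₗ appendResource (Fin d) (Fin d) ρ) ≤
      ENNReal.ofReal (2 * (1 - 1 / (d : ℝ) ^ 2)) := by
  have : NeZero d := ⟨by omega⟩
  refine iSup_le fun n => iSup_le fun ω => iSup_le fun hω => ENNReal.ofReal_le_ofReal ?_
  -- Dephasing acts on `C = Fin d × Fin d`, hence `N = d²`; the reference is untouched.
  have h1 : idTensor (Fin n) (measureExchange d A₀ B₀ ∘ₗ appendResource (Fin d) (Fin d) ρ) ω =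
      pinching (idTensor (Fin n) (swapChannel d) ω) := by
    ext i j
    rw [idTensor_apply, LinearMap.comp_apply, measureExchange_appendResource hρ,
      idTensor_swapChannel]
    obtain ⟨r, c⟩ := i
    obtain ⟨s, c'⟩ := j
    by_cases h : c = c' <;> simp [pinching, h]
  rw [h1]
  refine (traceNorm_sub_pinching_le ⟨isCompletelyPositive_swapChannel n ω hω.1,
    (isTracePreserving_swapChannel.idTensor _ ω).trans hω.2⟩).trans_eq ?_
  simp [sq]

/-! ### The lower bound -/

section LowerBound

/-- Positivity on the vector `e_i - e_{π i}` bounds twice the real part of each entry by two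
diagonal entries. Summed over `i`, both diagonal sums equal the trace because `π` is a bijection. -/
lemma re_sum_apply_perm_le_trace {I : Type} [Fintype I] {J : Matrix I I ℂ} (hJ : J.PosSemidef)
    (π : Equiv.Perm I) : (∑ i, J i (π i)).re ≤ J.trace.re := by
  have h : ∀ i, 2 * (J i (π i)).re ≤ (J i i).re + (J (π i) (π i)).re := by
    intro i
    have h1 := (Complex.le_def.mp ((hJ.submatrix ![i, π i]).dotProduct_mulVec_nonneg ![1, -1])).1
    have h2 : (J (π i) i).re = (J i (π i)).re := by
      rw [← hJ.1.apply i (π i)]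
      simp
    simp [Matrix.mulVec, dotProduct, Fin.sum_univ_two, h2] at h1
    linarith
  have h3 := Finset.sum_le_sum fun i (_ : i ∈ Finset.univ) => h i
  rw [Finset.sum_add_distrib, Equiv.sum_comp π fun i => (J i i).re, ← Finset.mul_sum] at h3
  rw [Complex.re_sum, Matrix.trace, Complex.re_sum]
  simp only [Matrix.diag_apply]
  linarith

variable {d : ℕ}

/-- The maximally entangled vector, with norm the square root of the dimension. -/
def entangledVec (C : Type) [DecidableEq C] : C × C → ℂ := fun i => if i.1 = i.2 then 1 else 0

/-- This is the Choi matrix of `Φ`, through which entries of outputs become entries of a positive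
matrix. -/
lemma idTensor_entangledVec {C D : Type} [DecidableEq C] (Φ : SuperOp C D) (i j : C × D) :
    idTensor C Φ (Matrix.vecMulVec (entangledVec C) (star (entangledVec C))) i j =
      Φ (Matrix.single i.1 j.1 1) i.2 j.2 := by
  rw [idTensor_apply]
  refine congrFun (congrFun (congrArg Φ ?_) _) _
  ext c c'
  simp [entangledVec, Matrix.vecMulVec_apply, Matrix.single_apply, ite_and, apply_ite star]
  split_ifs <;> rfl

lemma trace_entangledVec {C : Type} [Fintype C] [DecidableEq C] :
    (Matrix.vecMulVec (entangledVec C) (star (entangledVec C))).trace = Fintype.card C := by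
  simp [Matrix.trace, Matrix.vecMulVec_apply, entangledVec, Fintype.sum_prod_type]

/-- The overlap of the Choi operator of a channel with that of the swap channel. -/
def swapOverlap (M : SuperOp (Fin d × Fin d) (Fin d × Fin d)) : ℂ :=
  ∑ x, ∑ y, M (Matrix.single x y 1) x.swap y.swap

lemma swapOverlap_swapChannel : swapOverlap (swapChannel d) = (d : ℂ) ^ 4 := by
  simp [swapOverlap, swapChannel_apply]
  ring

lemma re_swapOverlap_le {M : SuperOp (Fin d × Fin d) (Fin d × Fin d)} (hM : IsTracePreserving M)
    (hM' : IsCompletelyPositive (ptConj M)) : (swapOverlap M).re ≤ (d : ℝ) ^ 2 := by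
  -- The overlap consists of the entries of `M |a b⟩⟨a' b'|` at row `(b, a)`, column `(b', a')`.
  -- After partial transposition of input and output this entry of `J` has row `((a, b'), (b, a'))`,
  -- which is `e` of the summation index, and column `((a', b), (b', a))`, which is `π` of that row.
  let π : Equiv.Perm ((Fin d × Fin d) × (Fin d × Fin d)) :=
    ⟨fun i => ((i.2.2, i.2.1), (i.1.2, i.1.1)), fun i => ((i.2.2, i.2.1), (i.1.2, i.1.1)),
      fun _ => rfl, fun _ => rfl⟩
  let e : ((Fin d × Fin d) × (Fin d × Fin d)) ≃ ((Fin d × Fin d) × (Fin d × Fin d)) :=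
    ⟨fun i => ((i.1.1, i.2.2), (i.1.2, i.2.1)), fun i => ((i.1.1, i.2.1), (i.2.2, i.1.2)),
      fun _ => rfl, fun _ => rfl⟩
  set J := idTensor (Fin d × Fin d) (ptConj M)
    (Matrix.vecMulVec (entangledVec (Fin d × Fin d)) (star (entangledVec (Fin d × Fin d))))
    with hJ
  have hJpos : J.PosSemidef :=
    hM'.posSemidef_idTensor _ (Matrix.posSemidef_vecMulVec_self_star _)
  have htr : J.trace = (d : ℂ) ^ 2 := by
    -- Partial transposition does not change the trace.
    have hT : IsTracePreserving (ptConj M) := fun X => hM _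
    rw [hJ, hT.idTensor _ _, trace_entangledVec]
    simp [sq]
  have hsum : swapOverlap M = ∑ i, J i (π i) := by
    rw [swapOverlap, ← Fintype.sum_prod_type', ← e.sum_comp fun i => J i (π i)]
    refine Finset.sum_congr rfl fun i _ => ?_
    obtain ⟨⟨a, b⟩, a', b'⟩ := i
    rw [hJ, idTensor_entangledVec]
    have : partialTransposeB (Fin d) (Fin d) (Matrix.single (a, b') (a', b) 1) =
        Matrix.single (a, b) (a', b') 1 := by
      ext i j
      simp only [partialTransposeB_apply, Matrix.single_apply, Prod.ext_iff]
      congr 1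
      rw [eq_iff_iff]
      tauto
    simp [π, e, ptConj, this]
  rw [hsum]
  refine (re_sum_apply_perm_le_trace hJpos π).trans_eq ?_
  rw [htr]
  norm_cast

lemma le_diamondDist_swapChannel (hd : 1 ≤ d) {M : SuperOp (Fin d × Fin d) (Fin d × Fin d)}
    (hM : IsChannel M) (hM' : IsCompletelyPositive (ptConj M)) :
    ENNReal.ofReal (2 * (1 - 1 / (d : ℝ) ^ 2)) ≤ diamondDist (swapChannel d) M := by
  have hd0 : (d : ℂ) ≠ 0 := by
    rw [Nat.cast_ne_zero]
    omega
  -- The diamond distance only uses references `Fin n`, so the maximally entangled state is moved to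
  -- `Fin (d * d)`.
  let e : Fin (d * d) ≃ Fin d × Fin d := finProdFinEquiv.symm
  let Ω : Matrix ((Fin d × Fin d) × (Fin d × Fin d)) ((Fin d × Fin d) × (Fin d × Fin d)) ℂ :=
    Matrix.vecMulVec (entangledVec _) (star (entangledVec _))
  let ω : Matrix (Fin (d * d) × (Fin d × Fin d)) (Fin (d * d) × (Fin d × Fin d)) ℂ :=
    (((d : ℝ) ^ 2)⁻¹ : ℝ) • Ω.submatrix (Prod.map e id) (Prod.map e id)
  -- The normalized Choi vector of the swap.
  let w : Fin (d * d) × (Fin d × Fin d) → ℂ :=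
    fun i => (d : ℂ)⁻¹ * if (e i.1).swap = i.2 then 1 else 0
  have hω : IsState ω := by
    refine ⟨Matrix.PosSemidef.smul
      ((Matrix.posSemidef_vecMulVec_self_star _).submatrix _) (by positivity), ?_⟩
    have h : (Ω.submatrix (Prod.map e id) (Prod.map e id)).trace = Ω.trace :=
      (Equiv.prodCongr e (Equiv.refl _)).sum_comp fun i => Ω i i
    rw [Matrix.trace_smul, h, trace_entangledVec]
    simp only [Fintype.card_prod, Fintype.card_fin, Complex.real_smul]
    push_cast
    field_simp
  have hw : star w ⬝ᵥ w = 1 := by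
    simp only [dotProduct, Fintype.sum_prod_type (α₁ := Fin (d * d)), Pi.star_apply, w]
    simp [apply_ite star, ← ite_and]
    field_simp
  -- The factor `d⁻⁴` is `d⁻²` from `ω` and `d⁻¹` from each copy of `w`.
  have hexp : ∀ Φ : SuperOp (Fin d × Fin d) (Fin d × Fin d),
      star w ⬝ᵥ idTensor (Fin (d * d)) Φ ω *ᵥ w = ((d : ℂ) ^ 4)⁻¹ * swapOverlap Φ := by
    intro Φ
    have h1 : ∀ i j, idTensor (Fin (d * d)) Φ ω i j =
        ((d : ℂ) ^ 2)⁻¹ * Φ (Matrix.single (e i.1) (e j.1) 1) i.2 j.2 := by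
      intro i j
      rw [← idTensor_entangledVec Φ (e i.1, i.2) (e j.1, j.2)]
      have h2 : ω = (((d : ℂ) ^ 2)⁻¹) • Ω.submatrix (Prod.map e id) (Prod.map e id) := by
        ext i j
        simp [ω]
      rw [h2, map_smul]
      rfl
    simp only [dotProduct, Matrix.mulVec, h1, Fintype.sum_prod_type (α₁ := Fin (d * d)),
      Pi.star_apply, w]
    simp [apply_ite star, swapOverlap]
    rw [← e.sum_comp, Finset.mul_sum]
    refine Finset.sum_congr rfl fun r _ => ?_
    rw [← e.sum_comp, Finset.mul_sum, Finset.mul_sum]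
    refine Finset.sum_congr rfl fun s _ => ?_
    field_simp
  have hS := isCompletelyPositive_swapChannel (d * d) ω hω.1
  have hMω := hM.1 (d * d) ω hω.1
  have hlow := two_mul_expectation_le_traceNorm (hS.1.sub hMω.1) (by
    rw [Matrix.trace_sub, isTracePreserving_swapChannel.idTensor _ ω, hM.2.idTensor _ ω,
      sub_self]) w hw
  refine le_trans (ENNReal.ofReal_le_ofReal (le_trans ?_ hlow))
    (le_iSup_of_le (d * d) (le_iSup_of_le ω (le_iSup_of_le hω le_rfl)))
  rw [Matrix.sub_mulVec, dotProduct_sub, hexp, hexp, swapOverlap_swapChannel,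
    inv_mul_cancel₀ (pow_ne_zero _ hd0)]
  have h3 : (((d : ℂ) ^ 4)⁻¹ * swapOverlap M).re = ((d : ℝ) ^ 4)⁻¹ * (swapOverlap M).re := by
    rw [← Complex.re_ofReal_mul]
    push_cast
    rfl
  rw [Complex.sub_re, h3, Complex.one_re]
  have h4 : ((d : ℝ) ^ 4)⁻¹ * (swapOverlap M).re ≤ ((d : ℝ) ^ 4)⁻¹ * (d : ℝ) ^ 2 :=
    mul_le_mul_of_nonneg_left (re_swapOverlap_le hM.2 hM') (by positivity)
  have h5 : ((d : ℝ) ^ 4)⁻¹ * (d : ℝ) ^ 2 = 1 / (d : ℝ) ^ 2 := by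
    field_simp
  linarith

end LowerBound

/-! ### The simulation errors -/

lemma inv_two_mul_ofReal_two_mul (x : ℝ) :
    (2⁻¹ : ℝ≥0∞) * ENNReal.ofReal (2 * x) = ENNReal.ofReal x := by
  rw [ENNReal.ofReal_mul zero_le_two, ← mul_assoc, ENNReal.ofReal_ofNat,
    ENNReal.inv_mul_cancel two_ne_zero ENNReal.ofNat_ne_top, one_mul]

section Errors

variable {d : ℕ} {A₀ B₀ : Type} [Fintype A₀] [Fintype B₀] {ρ : Matrix (A₀ × B₀) (A₀ × B₀) ℂ}

lemma errPPT_le_errLOCC {A B A' B' : Type} [Fintype A] [Fintype B] [Fintype A'] [Fintype B']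
    [DecidableEq A'] [DecidableEq B'] (N : SuperOp (A × B) (A' × B')) :
    errPPT N ρ ≤ errLOCC N ρ :=
  le_iInf₂ fun L hL => iInf₂_le L hL.isCPPTP

lemma errLOCC_swapChannel_le (hd : 1 ≤ d) (hρ : IsState ρ) :
    errLOCC (swapChannel d) ρ ≤ ENNReal.ofReal (1 - 1 / (d : ℝ) ^ 2) := by
  refine iInf₂_le_of_le _ (isLOCC_measureExchange A₀ B₀) ?_
  rw [← inv_two_mul_ofReal_two_mul]
  exact mul_le_mul_right (diamondDist_swapChannel_measureExchange_le hd hρ.2) _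

/-- The PPT property of `ρ` enters here: `ptConj` turns appending `ρ` into appending its partial
transpose, which is completely positive when that matrix is positive. -/
lemma le_errPPT_swapChannel (hd : 1 ≤ d) (hρ : IsPPTState ρ) :
    ENNReal.ofReal (1 - 1 / (d : ℝ) ^ 2) ≤ errPPT (swapChannel d) ρ := by
  refine le_iInf₂ fun P hP => ?_
  rw [← inv_two_mul_ofReal_two_mul]
  refine mul_le_mul_right (le_diamondDist_swapChannel hd
    ⟨hP.1.1.comp (isCompletelyPositive_appendResource hρ.1.1),
      hP.1.2.comp (isTracePreserving_appendResource hρ.1.2)⟩ ?_) _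
  rw [ptConj_comp, ptConj_appendResource]
  exact IsCompletelyPositive.comp hP.2 (isCompletelyPositive_appendResource hρ.2)

lemma IsPPTState.errors_swapChannel (hd : 1 ≤ d) (hρ : IsPPTState ρ) :
    errPPT (swapChannel d) ρ = ENNReal.ofReal (1 - 1 / (d : ℝ) ^ 2) ∧
      errLOCC (swapChannel d) ρ = ENNReal.ofReal (1 - 1 / (d : ℝ) ^ 2) :=
  have h1 := le_errPPT_swapChannel hd hρ
  have h2 := errLOCC_swapChannel_le hd hρ.1
  have h3 := errPPT_le_errLOCC (ρ := ρ) (swapChannel d)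
  ⟨(h3.trans h2).antisymm h1, h2.antisymm (h1.trans h3)⟩

end Errors

end BidirectionalTeleportation

end

theorem mainTheorem1 (d : ℕ) (hd : 1 ≤ d) :
    -- no resource state
    (BidirectionalTeleportation.errPPT (BidirectionalTeleportation.swapChannel d)
          BidirectionalTeleportation.noResource = ENNReal.ofReal (1 - 1 / (d : ℝ) ^ 2) ∧
      BidirectionalTeleportation.errLOCC (BidirectionalTeleportation.swapChannel d)
          BidirectionalTeleportation.noResource = ENNReal.ofReal (1 - 1 / (d : ℝ) ^ 2)) ∧
    -- a separable resource state
    (∀ (A₀ B₀ : Type) [Fintype A₀] [Fintype B₀] (ρ : Matrix (A₀ × B₀) (A₀ × B₀) ℂ),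
      BidirectionalTeleportation.IsSeparableState ρ →
        BidirectionalTeleportation.errPPT (BidirectionalTeleportation.swapChannel d) ρ =
            ENNReal.ofReal (1 - 1 / (d : ℝ) ^ 2) ∧
          BidirectionalTeleportation.errLOCC (BidirectionalTeleportation.swapChannel d) ρ =
            ENNReal.ofReal (1 - 1 / (d : ℝ) ^ 2)) ∧
    -- a PPT resource state
    (∀ (A₀ B₀ : Type) [Fintype A₀] [Fintype B₀] (ρ : Matrix (A₀ × B₀) (A₀ × B₀) ℂ),
      BidirectionalTeleportation.IsPPTState ρ →
        BidirectionalTeleportation.errPPT (BidirectionalTeleportation.swapChannel d) ρ =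
            ENNReal.ofReal (1 - 1 / (d : ℝ) ^ 2) ∧
          BidirectionalTeleportation.errLOCC (BidirectionalTeleportation.swapChannel d) ρ =
            ENNReal.ofReal (1 - 1 / (d : ℝ) ^ 2)) := by
  exact ⟨BidirectionalTeleportation.isPPTState_noResource.errors_swapChannel hd,
    fun _ _ _ _ _ hρ => hρ.isPPTState.errors_swapChannel hd,
    fun _ _ _ _ _ hρ => hρ.errors_swapChannel hd⟩
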